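/- Let $H$ be a complex Hilbert space. For an interval $I\subseteq\mathbb R$ let $\sigma(I)$ be the set of bounded self-adjoint operators on $H$ with spectrum contained in $I$; for $A\in\sigma(I)$ and a continuous $g:I\to\mathbb R$, $g(A)$ is given by the continuous functional calculus. All norms of operators are operator norms. Let $f:(0,\infty)\to\mathbb R$ be a $C^2$ function such that (a) $f\in\mathcal D^{(1)}$, i.e. for every $A\in\sigma((0,\infty))$ the map $X\mapsto f(X)$, considered near $A$ on the real Banach space of bounded self-adjoint operators on $H$, has a Fréchet derivative $Df(A)$ at $A$, and $\|Df(A)\|=\|f'(A)\|$, where $\|Df(A)\|=\sup\{\|Df(A)(X)\| : X=X^*,\ \|X\|=1\}$; (b) the function $A\mapsto\|f'(A)\|$ is convex on $\sigma((0,\infty))$. Then for all $A,B\in\sigma((0,\infty))$ (i.e. positive definite operators with spectrum in $(0,\infty)$) and all $0\le\nu\le1$, the function $t\mapsto f((1-t)A+tB)$ is (Bochner) integrable on $[0,1]$ and $$\left\|\nu f(A)+(1-\nu)f(B)-\int_0^1 f\big((1-t)A+tB\big)\,dt\right\|\le\frac16\left[2(1-\nu)^3-3(1-\nu)+2\right]\|f'(A)\|\,\|B-A\|+\frac16\left(2\nu^3-3\nu+2\right)\|f'(B)\|\,\|B-A\|.$$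 -/

import Mathlib

/-- `σ(I)`: the bounded self-adjoint operators on `H` whose spectrum is contained in `I`.
For `I = (0, ∞)` these are the positive definite (invertible) operators. -/
def operatorsWithSpectrumIn (H : Type*) [NormedAddCommGroup H] [InnerProductSpace ℂ H]
    [CompleteSpace H] (I : Set ℝ) : Set (H →L[ℂ] H) :=
  {A | IsSelfAdjoint A ∧ spectrum ℝ A ⊆ I}

/-- The map `X ↦ f(X)` (continuous functional calculus) induced by a real function `f` on the
real Banach space of bounded self-adjoint operators, with the operator norm. -/
noncomputable def inducedMap (H : Type*) [NormedAddCommGroup H] [InnerProductSpace ℂ H]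
    [CompleteSpace H] (f : ℝ → ℝ) (X : selfAdjoint.submodule ℝ (H →L[ℂ] H)) : selfAdjoint.submodule ℝ (H →L[ℂ] H) :=
  ⟨cfc f (X : H →L[ℂ] H), cfc_predicate f (X : H →L[ℂ] H)⟩

/-- The class `𝒟⁽¹⁾` over `H`: at every positive definite `A` the induced map has a
Fréchet derivative `Df(A)`, a bounded real-linear map on the self-adjoint operators, and its
operator norm `sup {‖Df(A)(B)‖ : ‖B‖ = 1}` equals `‖f'(A)‖`. -/
def classD1 (H : Type*) [NormedAddCommGroup H] [InnerProductSpace ℂ H] [CompleteSpace H] :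
    Set (ℝ → ℝ) :=
  {f | ∀ A : selfAdjoint.submodule ℝ (H →L[ℂ] H),
    (A : H →L[ℂ] H) ∈ operatorsWithSpectrumIn H (Set.Ioi 0) →
      DifferentiableAt ℝ (inducedMap H f) A ∧
        ‖fderiv ℝ (inducedMap H f) A‖ = ‖cfc (deriv f) (A : H →L[ℂ] H)‖}

/-! Put `φ t = f((1-t)A + tB)`. Integrating by parts against `t - ν` turns the weighted endpoint
error into `∫ (t - ν) φ'(t) dt`. The chain rule and `‖Df‖ = ‖f'‖` bound `‖φ'(t)‖` by `‖f'((1-t)A +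
tB)‖ ‖B - A‖`, and convexity makes this bound affine in `t`. The two constants are the integrals of
`|t - ν|(1-t)` and `|t - ν|t`. -/

theorem hasDerivAt_cfc_segment {H : Type*} [NormedAddCommGroup H] [InnerProductSpace ℂ H]
    [CompleteSpace H] {f : ℝ → ℝ} (hfD : f ∈ classD1 H)
    (A B : selfAdjoint.submodule ℝ (H →L[ℂ] H)) {t : ℝ}
    (ht : (1 - t) • (A : H →L[ℂ] H) + t • (B : H →L[ℂ] H) ∈
      operatorsWithSpectrumIn H (Set.Ioi 0)) :
    ∃ D : H →L[ℂ] H,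
      HasDerivAt (fun s : ℝ => cfc f ((1 - s) • (A : H →L[ℂ] H) + s • (B : H →L[ℂ] H))) D t ∧
      ‖D‖ ≤ ‖cfc (deriv f) ((1 - t) • (A : H →L[ℂ] H) + t • (B : H →L[ℂ] H))‖ *
        ‖(B : H →L[ℂ] H) - A‖ := by
  obtain ⟨hd, hn⟩ := hfD ((1 - t) • A + t • B) ht
  have hc : HasDerivAt (fun s : ℝ => (1 - s) • A + s • B) (B - A) t := by
    have h := (((hasDerivAt_id t).const_sub 1).smul_const A).add
      ((hasDerivAt_id t).smul_const B)
    refine h.congr_deriv ?_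
    module
  -- The derivative lives in the real space of self-adjoint operators; the isometric inclusion
  -- carries it to all operators.
  have hL := (selfAdjoint.submodule ℝ (H →L[ℂ] H)).subtypeL.hasFDerivAt.comp_hasDerivAt t
    (hd.hasFDerivAt.comp_hasDerivAt t hc)
  refine ⟨_, hL, ?_⟩
  calc ‖fderiv ℝ (inducedMap H f) ((1 - t) • A + t • B) (B - A)‖
      ≤ ‖fderiv ℝ (inducedMap H f) ((1 - t) • A + t • B)‖ * ‖B - A‖ :=
        ContinuousLinearMap.le_opNorm _ _
    _ = _ := by rw [hn]; rfl

theorem integral_abs_sub_mul_affine {ν : ℝ} (hν : ν ∈ Set.Icc (0 : ℝ) 1) (a b : ℝ) :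
    ∫ t in (0 : ℝ)..1, |t - ν| * ((1 - t) * a + t * b) =
      1 / 6 * (2 * (1 - ν) ^ 3 - 3 * (1 - ν) + 2) * a + 1 / 6 * (2 * ν ^ 3 - 3 * ν + 2) * b := by
  have hcont : Continuous fun t : ℝ => |t - ν| * ((1 - t) * a + t * b) := by fun_prop
  have hprim : ∀ x y : ℝ, ∫ t in x..y, (t - ν) * ((1 - t) * a + t * b) =
      (y ^ 3 / 3 * (b - a) + y ^ 2 / 2 * (a - ν * (b - a)) - ν * a * y) -
        (x ^ 3 / 3 * (b - a) + x ^ 2 / 2 * (a - ν * (b - a)) - ν * a * x) := by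
    intro x y
    refine intervalIntegral.integral_eq_sub_of_hasDerivAt
      (f := fun t => t ^ 3 / 3 * (b - a) + t ^ 2 / 2 * (a - ν * (b - a)) - ν * a * t)
      (fun t _ => ?_) (Continuous.intervalIntegrable (by fun_prop) _ _)
    have h := (((((hasDerivAt_id t).pow 3).div_const 3).mul_const (b - a)).add
      ((((hasDerivAt_id t).pow 2).div_const 2).mul_const (a - ν * (b - a)))).sub
      ((hasDerivAt_id t).const_mul (ν * a))
    refine h.congr_deriv ?_
    simp only [id_eq, Nat.cast_ofNat]
    ring
  rw [← intervalIntegral.integral_add_adjacent_intervals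
    (hcont.intervalIntegrable 0 ν) (hcont.intervalIntegrable ν 1)]
  have h₁ : ∫ t in (0 : ℝ)..ν, |t - ν| * ((1 - t) * a + t * b) =
      -∫ t in (0 : ℝ)..ν, (t - ν) * ((1 - t) * a + t * b) := by
    rw [← intervalIntegral.integral_neg]
    refine intervalIntegral.integral_congr fun t ht => ?_
    rw [Set.uIcc_of_le hν.1] at ht
    simp only [abs_of_nonpos (sub_nonpos.2 ht.2), neg_mul]
  have h₂ : ∫ t in ν..(1 : ℝ), |t - ν| * ((1 - t) * a + t * b) =
      ∫ t in ν..(1 : ℝ), (t - ν) * ((1 - t) * a + t * b) := by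
    refine intervalIntegral.integral_congr fun t ht => ?_
    rw [Set.uIcc_of_le hν.2] at ht
    simp only [abs_of_nonneg (sub_nonneg.2 ht.1)]
  rw [h₁, h₂, hprim, hprim]
  ring

/-- Weighted trapezoid inequality for a curve whose derivative is dominated by an affine
function. -/
theorem norm_weighted_trapezoid_sub_integral_le {E : Type*} [NormedAddCommGroup E]
    [NormedSpace ℝ E] [CompleteSpace E] {φ φ' : ℝ → E} {a b ν : ℝ}
    (hφ : ∀ t ∈ Set.Icc (0 : ℝ) 1, HasDerivAt φ (φ' t) t)
    (hbound : ∀ t ∈ Set.Icc (0 : ℝ) 1, ‖φ' t‖ ≤ (1 - t) * a + t * b)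
    (hν : ν ∈ Set.Icc (0 : ℝ) 1) :
    IntervalIntegrable φ MeasureTheory.volume 0 1 ∧
    ‖ν • φ 0 + (1 - ν) • φ 1 - ∫ t in (0 : ℝ)..1, φ t‖ ≤
      1 / 6 * (2 * (1 - ν) ^ 3 - 3 * (1 - ν) + 2) * a +
        1 / 6 * (2 * ν ^ 3 - 3 * ν + 2) * b := by
  have huIcc : Set.uIcc (0 : ℝ) 1 = Set.Icc 0 1 := Set.uIcc_of_le zero_le_one
  have hint : IntervalIntegrable φ MeasureTheory.volume 0 1 :=
    ContinuousOn.intervalIntegrable fun t ht =>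
      (hφ t (huIcc ▸ ht)).continuousAt.continuousWithinAt
  have hmaj : Continuous fun t : ℝ => |t - ν| * ((1 - t) * a + t * b) := by fun_prop
  have hle : ∀ t ∈ Set.Icc (0 : ℝ) 1,
      ‖(t - ν) • deriv φ t‖ ≤ |t - ν| * ((1 - t) * a + t * b) := fun t ht => by
    rw [norm_smul, Real.norm_eq_abs, (hφ t ht).deriv]
    exact mul_le_mul_of_nonneg_left (hbound t ht) (abs_nonneg _)
  -- No continuity of the derivative is needed: `deriv φ` is always strongly measurable, unlike an
  -- arbitrary `φ'`, and the affine majorant dominates it.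
  have hint' : IntervalIntegrable (fun t => (t - ν) • deriv φ t) MeasureTheory.volume 0 1 := by
    refine (hmaj.intervalIntegrable 0 1).mono_fun' ?_ ?_
    · exact ((by fun_prop : Continuous fun t : ℝ => t - ν).stronglyMeasurable.smul
        (stronglyMeasurable_deriv φ)).aestronglyMeasurable
    · filter_upwards [MeasureTheory.ae_restrict_mem measurableSet_uIoc] with t ht
      exact hle t (huIcc ▸ Set.uIoc_subset_uIcc ht)
  have hparts : ∫ t in (0 : ℝ)..1, (t - ν) • deriv φ t =
      ν • φ 0 + (1 - ν) • φ 1 - ∫ t in (0 : ℝ)..1, φ t := by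
    have h := intervalIntegral.integral_eq_sub_of_hasDerivAt (f := fun t => (t - ν) • φ t)
      (f' := fun t => (t - ν) • deriv φ t + φ t) (a := 0) (b := 1) (fun t ht => by
        have hd := hφ t (huIcc ▸ ht)
        rw [hd.deriv]
        exact (((hasDerivAt_id t).sub_const ν).smul hd).congr_deriv (by simp)) (hint'.add hint)
    rw [intervalIntegral.integral_add hint' hint] at h
    rw [eq_sub_of_add_eq h]
    module
  refine ⟨hint, ?_⟩
  rw [← hparts, ← integral_abs_sub_mul_affine hν a b]
  exact intervalIntegral.norm_integral_le_of_norm_le zero_le_one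
    (Filter.Eventually.of_forall fun t ht => hle t (Set.Ioc_subset_Icc_self ht))
    (hmaj.intervalIntegrable 0 1)

theorem proposition2p4 {H : Type*} [NormedAddCommGroup H] [InnerProductSpace ℂ H]
    [CompleteSpace H] (f : ℝ → ℝ)
    (hf : ContDiffOn ℝ 2 f (Set.Ioi 0))
    (hfD : f ∈ classD1 H)
    (hconv : ConvexOn ℝ (operatorsWithSpectrumIn H (Set.Ioi 0))
      (fun X : H →L[ℂ] H => ‖cfc (deriv f) X‖))
    (A B : H →L[ℂ] H)
    (hA : A ∈ operatorsWithSpectrumIn H (Set.Ioi 0))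
    (hB : B ∈ operatorsWithSpectrumIn H (Set.Ioi 0))
    (ν : ℝ) (hν : ν ∈ Set.Icc (0 : ℝ) 1) :
    IntervalIntegrable (fun t : ℝ => cfc f ((1 - t) • A + t • B)) MeasureTheory.volume 0 1 ∧
    ‖ν • cfc f A + (1 - ν) • cfc f B - ∫ t in (0 : ℝ)..1, cfc f ((1 - t) • A + t • B)‖ ≤
      1 / 6 * (2 * (1 - ν) ^ 3 - 3 * (1 - ν) + 2) * ‖cfc (deriv f) A‖ * ‖B - A‖ +
      1 / 6 * (2 * ν ^ 3 - 3 * ν + 2) * ‖cfc (deriv f) B‖ * ‖B - A‖ := by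

  have hmem : ∀ t ∈ Set.Icc (0 : ℝ) 1,
      (1 - t) • A + t • B ∈ operatorsWithSpectrumIn H (Set.Ioi 0) := fun t ht =>
    -- `ConvexOn` already includes convexity of the set of positive definite operators.
    hconv.1 hA hB (sub_nonneg.2 ht.2) ht.1 (sub_add_cancel 1 t)
  have hderiv : ∀ t ∈ Set.Icc (0 : ℝ) 1, _ := fun t ht =>
    hasDerivAt_cfc_segment hfD ⟨A, hA.1⟩ ⟨B, hB.1⟩ (hmem t ht)
  have hmain := norm_weighted_trapezoid_sub_integral_le
    (φ := fun t : ℝ => cfc f ((1 - t) • A + t • B)) (φ' := deriv _)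
    (a := ‖cfc (deriv f) A‖ * ‖B - A‖) (b := ‖cfc (deriv f) B‖ * ‖B - A‖)
    (fun t ht => by
      obtain ⟨D, hD, -⟩ := hderiv t ht
      exact hD.differentiableAt.hasDerivAt)
    (fun t ht => by
      obtain ⟨D, hD, hle⟩ := hderiv t ht
      have hcv := hconv.2 hA hB (sub_nonneg.2 ht.2) ht.1 (sub_add_cancel 1 t)
      simp only [smul_eq_mul] at hcv
      rw [hD.deriv, ← mul_assoc, ← mul_assoc, ← add_mul]
      exact hle.trans (mul_le_mul_of_nonneg_right hcv (norm_nonneg _))) hν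
  refine ⟨hmain.1, ?_⟩
  have h := hmain.2
  simp only [sub_zero, one_smul, zero_smul, add_zero, sub_self, zero_add, ← mul_assoc] at h
  exact h
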